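/- Let $\mu\ge 0$, let $H^1_0(0,1)=\{v\in H^1(0,1): v(0)=v(1)=0\}$ (real-valued functions), and let $\psi\in H^1_0(0,1)$, $\psi\neq 0$, be a weak solution of $-\psi''+\mu\psi-\psi^3=0$ on $(0,1)$ with $\psi(0)=\psi(1)=0$, i.e. $$\int_0^1\big[\psi_x v_x+\mu\psi v-\psi^3 v\big]\,dx=0\qquad\text{for all } v\in H^1_0(0,1).$$ Then (identifying $\psi$ with its continuous representative): (i) $\psi\in C^\infty(0,1)\cap C[0,1]$, and $\psi$ is a classical solution: $-\psi''+\mu\psi-\psi^3=0$ pointwise on $(0,1)$ and $\psi(0)=\psi(1)=0$. (ii) There is $j\in\{0,1,2,\dots\}$ such that $\psi$ has exactly $j$ zeros in $(0,1)$. (iii) For this $j$ the equation $\mu=4(j+1)^2(2k^2-1)K(k)^2$ has exactly one solution $k=k_j(\mu)\in[0,1)$, where $K(k)=\int_0^{\pi/2}(1-k^2\sin^2 t)^{-1/2}\,dt$, and either $\psi=\phi_j$ or $\psi=-\phi_j$ on $[0,1]$, where, with the Jacobi elliptic function $\mathrm{cn}$ and $[j]_2:=j \bmod 2$, $$\phi_j(x)=2\sqrt2\,(j+1)\,k\,K(k)\;\mathrm{cn}\Big(2(j+1)K(k)\big(x-\tfrac12\big)+[j]_2K(k),\,k\Big).$$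 If $\mu>0$, then also $$\phi_j(x)=\frac{\sqrt{2\mu}\,k}{\sqrt{2k^2-1}}\;\mathrm{cn}\Big(\frac{\sqrt\mu\,(x-\frac12)}{\sqrt{2k^2-1}}+[j]_2K(k),\,k\Big)\qquad(x\in\mathbb R).$$ -/

import Mathlib

open MeasureTheory Set
open scoped ContDiff

/-- Lebesgue measure on the open unit interval. -/
noncomputable def unitVol : Measure ℝ := volume.restrict (Ioo (0 : ℝ) 1)

/-- The function `u` belongs to `H¹(0,1)` and `u'` is (a representative of) its weak derivative.
Functions on the interval are represented by functions on the line; their values outside of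
`(0,1)` play no role. -/
structure MemH1 (u u' : ℝ → ℝ) : Prop where
  memLp : MemLp u 2 unitVol
  memLp_deriv : MemLp u' 2 unitVol
  weak_deriv : ∀ η : ℝ → ℝ, ContDiff ℝ ∞ η → HasCompactSupport η → tsupport η ⊆ Ioo (0 : ℝ) 1 →
    ∫ x, u x * deriv η x ∂unitVol = -∫ x, u' x * η x ∂unitVol

/-- The function `u` belongs to `H¹₀(0,1) = {v ∈ H¹(0,1) | v(0) = v(1) = 0}`, with weak
derivative `u'`. The boundary values are those of the continuous representative on `[0,1]`. -/
structure MemH10 (u u' : ℝ → ℝ) : Prop extends MemH1 u u' where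
  boundary : ∃ w : ℝ → ℝ, ContinuousOn w (Icc (0 : ℝ) 1) ∧ w =ᵐ[unitVol] u ∧ w 0 = 0 ∧ w 1 = 0

/-- Incomplete elliptic integral of the first kind `F(θ, k)`. -/
noncomputable def ellF (k θ : ℝ) : ℝ :=
  ∫ t in (0 : ℝ)..θ, 1 / Real.sqrt (1 - k ^ 2 * Real.sin t ^ 2)

/-- Complete elliptic integral of the first kind `K(k)`. -/
noncomputable def ellK (k : ℝ) : ℝ := ellF k (Real.pi / 2)

/-- Jacobi amplitude `am(u, k)`: the inverse function of `θ ↦ F(θ, k)`, which is a bijection of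
the line for `0 ≤ k < 1`. -/
noncomputable def jacobiAm (u k : ℝ) : ℝ := Function.invFun (ellF k) u

/-- Jacobi elliptic function `cn(u, k)`. -/
noncomputable def jacobiCn (u k : ℝ) : ℝ := Real.cos (jacobiAm u k)

/-- For `0 ≤ k < 1`, the map `θ ↦ F(θ, k)` is a bijection of the line. -/
theorem ellF_bijective {k : ℝ} (hk : k ∈ Ico (0 : ℝ) 1) : Function.Bijective (ellF k) := by
  have hk2 : k ^ 2 < 1 := by nlinarith [hk.1, hk.2]
  have hpos : ∀ t : ℝ, 0 < 1 - k ^ 2 * Real.sin t ^ 2 := fun t => by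
    nlinarith [Real.sin_sq_le_one t, sq_nonneg k, sq_nonneg (Real.sin t)]
  have hcont : Continuous fun t : ℝ => 1 / Real.sqrt (1 - k ^ 2 * Real.sin t ^ 2) :=
    Continuous.div continuous_const (by fun_prop)
      (fun t => (Real.sqrt_pos.2 (hpos t)).ne')
  have hint : ∀ a b : ℝ, IntervalIntegrable
      (fun t : ℝ => 1 / Real.sqrt (1 - k ^ 2 * Real.sin t ^ 2)) volume a b :=
    fun a b => hcont.intervalIntegrable a b
  have hone : ∀ t : ℝ, 1 ≤ 1 / Real.sqrt (1 - k ^ 2 * Real.sin t ^ 2) := fun t => by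
    rw [le_div_iff₀ (Real.sqrt_pos.2 (hpos t)), one_mul]
    exact Real.sqrt_le_one.2 (by nlinarith [mul_nonneg (sq_nonneg k) (sq_nonneg (Real.sin t))])
  have hgrow : ∀ a b : ℝ, a ≤ b → b - a ≤ ellF k b - ellF k a := fun a b hab => by
    have h1 : ellF k b - ellF k a
        = ∫ t in a..b, 1 / Real.sqrt (1 - k ^ 2 * Real.sin t ^ 2) :=
      intervalIntegral.integral_interval_sub_left (hint 0 b) (hint 0 a)
    have h2 := intervalIntegral.integral_mono_on hab
      (continuous_const.intervalIntegrable (μ := volume) a b) (hint a b) (fun t _ => hone t)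
    rw [h1]
    simpa using h2
  have h0 : ellF k 0 = 0 := by simp [ellF]
  have hc : Continuous (ellF k) := by
    unfold ellF
    exact intervalIntegral.continuous_primitive hint 0
  refine ⟨fun a b hab => ?_, hc.surjective ?_ ?_⟩
  · rcases le_total a b with h | h
    · linarith [hgrow a b h]
    · linarith [hgrow b a h]
  · refine Filter.tendsto_atTop_mono' _ ?_ Filter.tendsto_id
    filter_upwards [Filter.eventually_ge_atTop (0 : ℝ)] with x hx
    have := hgrow 0 x hx
    simp only [id]
    linarith
  · refine Filter.tendsto_atBot_mono' _ ?_ Filter.tendsto_id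
    filter_upwards [Filter.eventually_le_atBot (0 : ℝ)] with x hx
    have := hgrow x 0 hx
    simp only [id]
    linarith

/-- `k ∈ [0,1)` solves `μ = 4 (j+1)² (2k² - 1) K(k)²`. -/
def IsModulus (μ : ℝ) (j : ℕ) (k : ℝ) : Prop :=
  k ∈ Ico (0 : ℝ) 1 ∧ μ = 4 * ((j : ℝ) + 1) ^ 2 * (2 * k ^ 2 - 1) * ellK k ^ 2

/-- `2√2 (j+1) k K(k) cn(2 (j+1) K(k) (x - 1/2) + [j]₂ K(k), k)`, where `[j]₂ = j mod 2`. -/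
noncomputable def boundState (j : ℕ) (k x : ℝ) : ℝ :=
  2 * Real.sqrt 2 * ((j : ℝ) + 1) * k * ellK k *
    jacobiCn (2 * ((j : ℝ) + 1) * ellK k * (x - 1 / 2) + ((j % 2 : ℕ) : ℝ) * ellK k) k

/-- `√(2μ) k / √(2k²-1) · cn(√μ (x - 1/2) / √(2k²-1) + [j]₂ K(k), k)`, used for `μ > 0`. -/
noncomputable def boundStateFreq (μ : ℝ) (j : ℕ) (k x : ℝ) : ℝ :=
  Real.sqrt (2 * μ) * k / Real.sqrt (2 * k ^ 2 - 1) *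
    jacobiCn (Real.sqrt μ * (x - 1 / 2) / Real.sqrt (2 * k ^ 2 - 1)
      + ((j % 2 : ℕ) : ℝ) * ellK k) k

/-!
Integrating by parts, `ψ'` has the continuous weak derivative `μ ψ - ψ³`, so by du Bois-Reymond's
lemma, applied to `ψ'` and then to `ψ`, the continuous representative of `ψ` is a classical solution
of `u'' = μ u - u³` on `[0, 1]`. By uniqueness for the initial value problem, `u` is determined by
its slope at `0`, which is nonzero; up to sign it is positive, and exactly one cnoidal wave
`√2 k w cn (w x - K(k), k)` with `μ = w² (2 k² - 1)` has this slope. It vanishes at `1` only if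
`w = 2 (j + 1) K(k)` with `j ∈ ℕ`, and then has exactly `j` zeros in `(0, 1)`. Finally `k` is
determined by `μ` and `j` because `(2 k² - 1) K(k)²` is strictly increasing in `k`.
-/

section EllipticIntegral

variable {k l : ℝ}

theorem one_sub_sq_mul_sin_sq_pos (hk : k ^ 2 < 1) (t : ℝ) :
    0 < 1 - k ^ 2 * Real.sin t ^ 2 := by
  nlinarith [Real.sin_sq_le_one t, sq_nonneg k, sq_nonneg (Real.sin t)]

theorem continuous_ellF_integrand (hk : k ^ 2 < 1) :
    Continuous fun t : ℝ => 1 / √(1 - k ^ 2 * Real.sin t ^ 2) :=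
  continuous_const.div (by fun_prop) fun t => (Real.sqrt_pos.2 (one_sub_sq_mul_sin_sq_pos hk t)).ne'

theorem intervalIntegrable_ellF_integrand (hk : k ^ 2 < 1) (a b : ℝ) :
    IntervalIntegrable (fun t : ℝ => 1 / √(1 - k ^ 2 * Real.sin t ^ 2)) volume a b :=
  (continuous_ellF_integrand hk).intervalIntegrable a b

theorem ellF_sub_ellF (hk : k ^ 2 < 1) (a b : ℝ) :
    ellF k b - ellF k a = ∫ t in a..b, 1 / √(1 - k ^ 2 * Real.sin t ^ 2) :=
  intervalIntegral.integral_interval_sub_left (intervalIntegrable_ellF_integrand hk 0 b)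
    (intervalIntegrable_ellF_integrand hk 0 a)

theorem hasDerivAt_ellF (hk : k ^ 2 < 1) (θ : ℝ) :
    HasDerivAt (ellF k) (1 / √(1 - k ^ 2 * Real.sin θ ^ 2)) θ :=
  ((continuous_ellF_integrand hk).integral_hasStrictDerivAt 0 θ).hasDerivAt

theorem strictMono_ellF (hk : k ^ 2 < 1) : StrictMono (ellF k) :=
  strictMono_of_hasDerivAt_pos (hasDerivAt_ellF hk) fun θ =>
    one_div_pos.2 (Real.sqrt_pos.2 (one_sub_sq_mul_sin_sq_pos hk θ))

theorem ellF_zero (k : ℝ) : ellF k 0 = 0 := intervalIntegral.integral_same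

theorem ellF_neg (k θ : ℝ) : ellF k (-θ) = -ellF k θ := by
  have h := intervalIntegral.integral_comp_neg (a := 0) (b := θ)
    (fun t => 1 / √(1 - k ^ 2 * Real.sin t ^ 2))
  simp only [Real.sin_neg, neg_sq, neg_zero] at h
  rw [ellF, intervalIntegral.integral_symm, ← h, ellF]

theorem ellF_bijective_of_sq_lt_one (hk : k ^ 2 < 1) : Function.Bijective (ellF k) := by
  have hF : ellF |k| = ellF k := by
    ext θ
    simp only [ellF, sq_abs]
  exact hF ▸ ellF_bijective ⟨abs_nonneg k, (sq_lt_one_iff_abs_lt_one k).1 hk⟩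

theorem ellK_pos (hk : k ^ 2 < 1) : 0 < ellK k := by
  rw [ellK, ← ellF_zero k]
  exact strictMono_ellF hk Real.pi_div_two_pos

theorem ellF_add_pi (hk : k ^ 2 < 1) (θ : ℝ) : ellF k (θ + Real.pi) = ellF k θ + 2 * ellK k := by
  have hper : Function.Periodic (fun t : ℝ => 1 / √(1 - k ^ 2 * Real.sin t ^ 2)) Real.pi :=
    fun t => by simp only [Real.sin_add_pi, neg_sq]
  have h := hper.intervalIntegral_add_eq θ (-(Real.pi / 2))
  rw [show -(Real.pi / 2) + Real.pi = Real.pi / 2 by ring, ← ellF_sub_ellF hk,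
    ← ellF_sub_ellF hk, ellF_neg, ← ellK] at h
  linarith

theorem ellF_add_int_mul_pi (hk : k ^ 2 < 1) (θ : ℝ) (m : ℤ) :
    ellF k (θ + m * Real.pi) = ellF k θ + m * (2 * ellK k) := by
  let F : AddConstMap ℝ ℝ Real.pi (2 * ellK k) := ⟨ellF k, ellF_add_pi hk⟩
  have h := AddConstMapClass.map_add_zsmul F θ m
  simp only [zsmul_eq_mul] at h
  exact h

theorem ellK_le_ellK (hkl : k ^ 2 ≤ l ^ 2) (hl : l ^ 2 < 1) : ellK k ≤ ellK l := by
  refine intervalIntegral.integral_mono_on Real.pi_div_two_pos.le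
    (intervalIntegrable_ellF_integrand (hkl.trans_lt hl) _ _)
    (intervalIntegrable_ellF_integrand hl _ _) fun t _ => ?_
  have := Real.sqrt_pos.2 (one_sub_sq_mul_sin_sq_pos hl t)
  gcongr

theorem sqrt_one_sub_sq_mul_ellK_le (hkl : k ^ 2 ≤ l ^ 2) (hl : l ^ 2 < 1) :
    √(1 - l ^ 2) * ellK l ≤ √(1 - k ^ 2) * ellK k := by
  have hk := hkl.trans_lt hl
  simp only [ellK, ellF, ← intervalIntegral.integral_const_mul]
  refine intervalIntegral.integral_mono_on Real.pi_div_two_pos.le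
    ((intervalIntegrable_ellF_integrand hl _ _).const_mul _)
    ((intervalIntegrable_ellF_integrand hk _ _).const_mul _) fun t _ => ?_
  have hk0 := one_sub_sq_mul_sin_sq_pos hk t
  have hl0 := one_sub_sq_mul_sin_sq_pos hl t
  rw [mul_one_div, mul_one_div, ← Real.sqrt_div (sub_pos.2 hl).le,
    ← Real.sqrt_div (sub_pos.2 hk).le]
  refine Real.sqrt_le_sqrt ((div_le_div_iff₀ hl0 hk0).2 ?_)
  nlinarith [Real.sin_sq_le_one t]

/- For `1 ≤ 2 l²` the claim follows from the monotonicity of `K(k)`, and for `2 l² < 1` from that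
of `(1 - k²) K(k)²`, because `(2 k² - 1) / (1 - k²)` is increasing in `k²`. -/
theorem two_mul_sq_sub_one_mul_ellK_sq_lt (hkl : k ^ 2 < l ^ 2) (hl : l ^ 2 < 1) :
    (2 * k ^ 2 - 1) * ellK k ^ 2 < (2 * l ^ 2 - 1) * ellK l ^ 2 := by
  have hk := hkl.trans hl
  have hKk := ellK_pos hk
  rcases le_or_gt 1 (2 * l ^ 2) with h | h
  · calc (2 * k ^ 2 - 1) * ellK k ^ 2 < (2 * l ^ 2 - 1) * ellK k ^ 2 := by gcongr
      _ ≤ (2 * l ^ 2 - 1) * ellK l ^ 2 := by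
        have := ellK_le_ellK hkl.le hl
        have : 0 ≤ 2 * l ^ 2 - 1 := by linarith
        gcongr
  · have hl' : 0 < 1 - l ^ 2 := by linarith
    have hmono : (1 - l ^ 2) * ellK l ^ 2 ≤ (1 - k ^ 2) * ellK k ^ 2 := by
      have := pow_le_pow_left₀ (by have := ellK_pos hl; positivity)
        (sqrt_one_sub_sq_mul_ellK_le hkl.le hl) 2
      rwa [mul_pow, mul_pow, Real.sq_sqrt hl'.le, Real.sq_sqrt (sub_pos.2 hk).le] at this
    refine lt_of_mul_lt_mul_left ?_ hl'.le
    calc (1 - l ^ 2) * ((2 * k ^ 2 - 1) * ellK k ^ 2)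
        < (2 * l ^ 2 - 1) * ((1 - k ^ 2) * ellK k ^ 2) := by nlinarith [pow_pos hKk 2]
      _ ≤ (2 * l ^ 2 - 1) * ((1 - l ^ 2) * ellK l ^ 2) :=
        mul_le_mul_of_nonpos_left hmono (by linarith)
      _ = (1 - l ^ 2) * ((2 * l ^ 2 - 1) * ellK l ^ 2) := by ring

end EllipticIntegral

section JacobiFunctions

variable {k : ℝ}

/-- Jacobi elliptic function `sn(u, k)`. -/
noncomputable def jacobiSn (u k : ℝ) : ℝ := Real.sin (jacobiAm u k)

/-- Jacobi elliptic function `dn(u, k)`, in the form `√(1 - k² sn²)` valid for `k² < 1`, where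
`dn` is positive. -/
noncomputable def jacobiDn (u k : ℝ) : ℝ := √(1 - k ^ 2 * jacobiSn u k ^ 2)

theorem jacobiSn_sq_add_jacobiCn_sq (u k : ℝ) : jacobiSn u k ^ 2 + jacobiCn u k ^ 2 = 1 :=
  Real.sin_sq_add_cos_sq _

theorem jacobiDn_pos (hk : k ^ 2 < 1) (u : ℝ) : 0 < jacobiDn u k :=
  Real.sqrt_pos.2 (one_sub_sq_mul_sin_sq_pos hk _)

theorem jacobiDn_sq (hk : k ^ 2 < 1) (u : ℝ) : jacobiDn u k ^ 2 = 1 - k ^ 2 * jacobiSn u k ^ 2 :=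
  Real.sq_sqrt (one_sub_sq_mul_sin_sq_pos hk _).le

theorem ellF_jacobiAm (hk : k ^ 2 < 1) (u : ℝ) : ellF k (jacobiAm u k) = u :=
  Function.rightInverse_invFun (ellF_bijective_of_sq_lt_one hk).2 u

theorem jacobiAm_eq_iff (hk : k ^ 2 < 1) {u θ : ℝ} : jacobiAm u k = θ ↔ u = ellF k θ := by
  rw [← (ellF_bijective_of_sq_lt_one hk).1.eq_iff, ellF_jacobiAm hk]

theorem jacobiAm_add_two_mul_ellK (hk : k ^ 2 < 1) (u : ℝ) :
    jacobiAm (u + 2 * ellK k) k = jacobiAm u k + Real.pi := by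
  rw [jacobiAm_eq_iff hk, ellF_add_pi hk, ellF_jacobiAm hk]

theorem jacobiAm_neg_ellK (hk : k ^ 2 < 1) : jacobiAm (-ellK k) k = -(Real.pi / 2) := by
  rw [jacobiAm_eq_iff hk, ellF_neg, ellK]

theorem jacobiSn_neg_ellK (hk : k ^ 2 < 1) : jacobiSn (-ellK k) k = -1 := by
  rw [jacobiSn, jacobiAm_neg_ellK hk, Real.sin_neg, Real.sin_pi_div_two]

theorem jacobiCn_neg_ellK (hk : k ^ 2 < 1) : jacobiCn (-ellK k) k = 0 := by
  rw [jacobiCn, jacobiAm_neg_ellK hk, Real.cos_neg, Real.cos_pi_div_two]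

theorem jacobiCn_antiperiodic (hk : k ^ 2 < 1) :
    Function.Antiperiodic (fun u => jacobiCn u k) (2 * ellK k) := fun u => by
  simp only [jacobiCn, jacobiAm_add_two_mul_ellK hk, Real.cos_add_pi]

theorem jacobiCn_eq_zero_iff (hk : k ^ 2 < 1) {u : ℝ} :
    jacobiCn u k = 0 ↔ ∃ m : ℤ, u = (2 * m + 1) * ellK k := by
  rw [jacobiCn, Real.cos_eq_zero_iff]
  refine exists_congr fun m => ?_
  rw [show (2 * (m : ℝ) + 1) * Real.pi / 2 = Real.pi / 2 + m * Real.pi by ring,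
    jacobiAm_eq_iff hk, ellF_add_int_mul_pi hk, ← ellK]
  ring_nf

theorem continuous_jacobiAm (hk : k ^ 2 < 1) : Continuous fun u => jacobiAm u k := by
  refine Monotone.continuous_of_surjective (fun u v huv => ?_)
    fun θ => ⟨ellF k θ, (jacobiAm_eq_iff hk).2 rfl⟩
  rwa [← (strictMono_ellF hk).le_iff_le, ellF_jacobiAm hk, ellF_jacobiAm hk]

theorem hasDerivAt_jacobiAm (hk : k ^ 2 < 1) (u : ℝ) :
    HasDerivAt (fun u => jacobiAm u k) (jacobiDn u k) u := by
  have h := HasDerivAt.of_local_left_inverse (continuous_jacobiAm hk).continuousAt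
    (hasDerivAt_ellF hk (jacobiAm u k)) (one_div_pos.2 (jacobiDn_pos hk u)).ne'
    (Filter.Eventually.of_forall (ellF_jacobiAm hk))
  exact h.congr_deriv (by rw [one_div, inv_inv, jacobiDn, jacobiSn])

theorem hasDerivAt_jacobiSn (hk : k ^ 2 < 1) (u : ℝ) :
    HasDerivAt (fun u => jacobiSn u k) (jacobiCn u k * jacobiDn u k) u :=
  (hasDerivAt_jacobiAm hk u).sin

theorem hasDerivAt_jacobiCn (hk : k ^ 2 < 1) (u : ℝ) :
    HasDerivAt (fun u => jacobiCn u k) (-(jacobiSn u k * jacobiDn u k)) u :=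
  (hasDerivAt_jacobiAm hk u).cos.congr_deriv (neg_mul _ _)

theorem hasDerivAt_jacobiDn (hk : k ^ 2 < 1) (u : ℝ) :
    HasDerivAt (fun u => jacobiDn u k) (-(k ^ 2 * jacobiSn u k * jacobiCn u k)) u := by
  have h := ((((hasDerivAt_jacobiSn hk u).fun_pow 2).const_mul (k ^ 2)).const_sub 1).sqrt
    (one_sub_sq_mul_sin_sq_pos hk _).ne'
  refine h.congr_deriv ?_
  rw [← jacobiDn, div_eq_iff (mul_pos two_pos (jacobiDn_pos hk u)).ne']
  push_cast
  ring

theorem hasDerivAt_neg_jacobiSn_mul_jacobiDn (hk : k ^ 2 < 1) (u : ℝ) :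
    HasDerivAt (fun u => -(jacobiSn u k * jacobiDn u k))
      ((2 * k ^ 2 - 1) * jacobiCn u k - 2 * k ^ 2 * jacobiCn u k ^ 3) u := by
  refine ((hasDerivAt_jacobiSn hk u).mul (hasDerivAt_jacobiDn hk u)).neg.congr_deriv ?_
  linear_combination -jacobiCn u k * jacobiDn_sq hk u
    + 2 * k ^ 2 * jacobiCn u k * jacobiSn_sq_add_jacobiCn_sq u k

end JacobiFunctions

section AutonomousODE

variable {E : Type*} [NormedAddCommGroup E] [NormedSpace ℝ E]

theorem eqOn_Icc_of_isIntegralCurveOn {F : E → E} {γ δ : ℝ → E} {a b : ℝ}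
    (hF : LocallyLipschitz F) (hγ : IsIntegralCurveOn γ (fun _ => F) (Icc a b))
    (hδ : IsIntegralCurveOn δ (fun _ => F) (Icc a b)) (h : γ a = δ a) : EqOn γ δ (Icc a b) := by
  have hγc : ContinuousOn γ (Icc a b) := fun t ht => (hγ t ht).continuousWithinAt
  have hδc : ContinuousOn δ (Icc a b) := fun t ht => (hδ t ht).continuousWithinAt
  obtain ⟨K, hK⟩ := LocallyLipschitzOn.exists_lipschitzOnWith_of_compact
    ((isCompact_Icc.image_of_continuousOn hγc).union (isCompact_Icc.image_of_continuousOn hδc))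
    hF.locallyLipschitzOn
  have right_deriv {ε : ℝ → E} (hε : IsIntegralCurveOn ε (fun _ => F) (Icc a b)) :
      ∀ t ∈ Ico a b, HasDerivWithinAt ε (F (ε t)) (Ici t) t := fun t ht =>
    (hε t (Ico_subset_Icc_self ht)).mono_of_mem_nhdsWithin (Icc_mem_nhdsGE_of_mem ht)
  exact ODE_solution_unique_of_mem_Icc_right (fun _ _ => hK) hγc (right_deriv hγ)
    (fun t ht => Or.inl (mem_image_of_mem γ (Ico_subset_Icc_self ht))) hδc (right_deriv hδ)
    (fun t ht => Or.inr (mem_image_of_mem δ (Ico_subset_Icc_self ht))) h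

theorem contDiffOn_of_isIntegralCurveOn {F : E → E} {γ : ℝ → E} {s : Set ℝ} (hF : ContDiff ℝ ∞ F)
    (hs : UniqueDiffOn ℝ s) (hγ : IsIntegralCurveOn γ (fun _ => F) s) : ContDiffOn ℝ ∞ γ s := by
  refine contDiffOn_infty.2 fun n => ?_
  induction n with
  | zero => exact contDiffOn_zero.2 fun t ht => (hγ t ht).continuousWithinAt
  | succ n ih =>
    rw [Nat.cast_succ, contDiffOn_succ_iff_derivWithin hs]
    refine ⟨fun t ht => (hγ t ht).differentiableWithinAt, fun h => absurd h (by simp), ?_⟩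
    exact ((contDiff_infty.1 hF n).comp_contDiffOn ih).congr fun t ht =>
      (hγ t ht).derivWithin (hs t ht)

/-- The function `u` solves Newton's equation `u'' = f(u)` on the set `s`, in the form of the first
order system `u' = p`, `p' = f(u)`. The derivatives are taken within `s`, so that on a compact
interval they are one-sided at the end points. -/
structure IsNewtonSolutionOn (f : E → E) (u p : ℝ → E) (s : Set ℝ) : Prop where
  hasDerivWithinAt : ∀ x ∈ s, HasDerivWithinAt u (p x) s x
  hasDerivWithinAt_velocity : ∀ x ∈ s, HasDerivWithinAt p (f (u x)) s x

namespace IsNewtonSolutionOn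

variable {f : E → E} {u p v q : ℝ → E} {s t : Set ℝ} {a b : ℝ}

theorem mono (h : IsNewtonSolutionOn f u p t) (hst : s ⊆ t) : IsNewtonSolutionOn f u p s where
  hasDerivWithinAt x hx := (h.hasDerivWithinAt x (hst hx)).mono hst
  hasDerivWithinAt_velocity x hx := (h.hasDerivWithinAt_velocity x (hst hx)).mono hst

theorem zero (hf : f 0 = 0) (s : Set ℝ) : IsNewtonSolutionOn f 0 0 s where
  hasDerivWithinAt x _ := hasDerivWithinAt_const x s 0
  hasDerivWithinAt_velocity x _ := (hasDerivWithinAt_const x s 0).congr_deriv hf.symm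

theorem neg (hf : f.Odd) (h : IsNewtonSolutionOn f u p s) : IsNewtonSolutionOn f (-u) (-p) s where
  hasDerivWithinAt x hx := (h.hasDerivWithinAt x hx).neg
  hasDerivWithinAt_velocity x hx :=
    (h.hasDerivWithinAt_velocity x hx).neg.congr_deriv (hf (u x)).symm

theorem continuousOn (h : IsNewtonSolutionOn f u p s) : ContinuousOn u s :=
  fun x hx => (h.hasDerivWithinAt x hx).continuousWithinAt

theorem isIntegralCurveOn (h : IsNewtonSolutionOn f u p s) :
    IsIntegralCurveOn (fun x => (u x, p x)) (fun _ z => (z.2, f z.1)) s := fun x hx =>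
  (h.hasDerivWithinAt x hx).prodMk (h.hasDerivWithinAt_velocity x hx)

theorem eqOn_Icc (hf : ContDiff ℝ 1 f) (h : IsNewtonSolutionOn f u p (Icc a b))
    (h' : IsNewtonSolutionOn f v q (Icc a b)) (hu : u a = v a) (hp : p a = q a) :
    EqOn u v (Icc a b) := by
  have hF : ContDiff ℝ 1 fun z : E × E => (z.2, f z.1) := by fun_prop
  exact fun x hx => congrArg Prod.fst (eqOn_Icc_of_isIntegralCurveOn hF.locallyLipschitz
    h.isIntegralCurveOn h'.isIntegralCurveOn (Prod.ext hu hp) hx)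

theorem contDiffOn (hf : ContDiff ℝ ∞ f) (hs : UniqueDiffOn ℝ s)
    (h : IsNewtonSolutionOn f u p s) : ContDiffOn ℝ ∞ u s := by
  have hF : ContDiff ℝ ∞ fun z : E × E => (z.2, f z.1) := by fun_prop
  exact (contDiffOn_of_isIntegralCurveOn hF hs h.isIntegralCurveOn).fst

theorem deriv_deriv (hs : IsOpen s) (h : IsNewtonSolutionOn f u p s) {x : ℝ} (hx : x ∈ s) :
    deriv (deriv u) x = f (u x) := by
  have hu : deriv u =ᶠ[nhds x] p := by
    filter_upwards [hs.mem_nhds hx] with y hy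
    exact ((h.hasDerivWithinAt y hy).hasDerivAt (hs.mem_nhds hy)).deriv
  rw [hu.deriv_eq]
  exact ((h.hasDerivWithinAt_velocity x hx).hasDerivAt (hs.mem_nhds hx)).deriv

end IsNewtonSolutionOn

end AutonomousODE

section CnoidalWaves

variable {k w μ : ℝ}

/-- The force `μ u - u³` of the Duffing oscillator: the boundary value problem is Newton's equation
`u'' = duffingForce μ u`. -/
def duffingForce (μ u : ℝ) : ℝ := μ * u - u ^ 3

theorem contDiff_duffingForce (μ : ℝ) : ContDiff ℝ ∞ (duffingForce μ) := by
  unfold duffingForce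
  fun_prop

theorem odd_duffingForce (μ : ℝ) : (duffingForce μ).Odd := fun u => by
  simp only [duffingForce]
  ring

/-- The cnoidal wave of modulus `k` and frequency `w`, shifted so as to vanish at `0` and to be
increasing there. -/
noncomputable def cnoidalWave (k w x : ℝ) : ℝ := √2 * k * w * jacobiCn (w * x - ellK k) k

/-- The derivative of `cnoidalWave k w`. -/
noncomputable def cnoidalWaveDeriv (k w x : ℝ) : ℝ :=
  √2 * k * w ^ 2 * -(jacobiSn (w * x - ellK k) k * jacobiDn (w * x - ellK k) k)

theorem isNewtonSolutionOn_cnoidalWave (hk : k ^ 2 < 1) (w : ℝ) (s : Set ℝ) :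
    IsNewtonSolutionOn (duffingForce (w ^ 2 * (2 * k ^ 2 - 1))) (cnoidalWave k w)
      (cnoidalWaveDeriv k w) s := by
  have hphase (x : ℝ) : HasDerivAt (fun x => w * x - ellK k) w x :=
    (hasDerivAt_const_mul w).sub_const (ellK k)
  refine ⟨fun x _ => ?_, fun x _ => ?_⟩
  · refine ((((hasDerivAt_jacobiCn hk _).comp x (hphase x)).const_mul _).congr_deriv
      ?_).hasDerivWithinAt
    rw [cnoidalWaveDeriv]
    ring
  · refine ((((hasDerivAt_neg_jacobiSn_mul_jacobiDn hk _).comp x (hphase x)).const_mul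
      _).congr_deriv ?_).hasDerivWithinAt
    rw [duffingForce, cnoidalWave]
    linear_combination √2 * k ^ 3 * w ^ 3 * jacobiCn (w * x - ellK k) k ^ 3
      * Real.sq_sqrt zero_le_two

theorem cnoidalWave_zero (hk : k ^ 2 < 1) (w : ℝ) : cnoidalWave k w 0 = 0 := by
  rw [cnoidalWave, mul_zero, zero_sub, jacobiCn_neg_ellK hk, mul_zero]

theorem cnoidalWaveDeriv_zero (hk : k ^ 2 < 1) (w : ℝ) :
    cnoidalWaveDeriv k w 0 = √2 * k * w ^ 2 * √(1 - k ^ 2) := by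
  rw [cnoidalWaveDeriv, mul_zero, zero_sub, jacobiDn, jacobiSn_neg_ellK hk]
  norm_num

theorem cnoidalWave_eq_zero_iff (hk0 : k ≠ 0) (hk : k ^ 2 < 1) (hw : w ≠ 0) {x : ℝ} :
    cnoidalWave k w x = 0 ↔ ∃ m : ℤ, w * x = 2 * m * ellK k := by
  have hamp : √2 * k * w ≠ 0 := by positivity
  rw [cnoidalWave, mul_eq_zero, or_iff_right hamp, jacobiCn_eq_zero_iff hk]
  constructor
  · rintro ⟨m, hm⟩
    exact ⟨m + 1, by push_cast; linear_combination hm⟩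
  · rintro ⟨m, hm⟩
    exact ⟨m - 1, by push_cast; linear_combination hm⟩

/- The equations say `μ + i√2 a = w² (cos 2α + i sin 2α)` for `k = cos α`, so `2α` is the argument
and `w²` the modulus of the left-hand side. -/
theorem exists_modulus_frequency (μ : ℝ) {a : ℝ} (ha : 0 < a) :
    ∃ k ∈ Ioo (0 : ℝ) 1, ∃ w > 0,
      μ = w ^ 2 * (2 * k ^ 2 - 1) ∧ a = √2 * k * w ^ 2 * √(1 - k ^ 2) := by
  set z : ℂ := ⟨μ, √2 * a⟩
  have him : 0 < z.im := by positivity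
  have hz : z ≠ 0 := fun h => him.ne' (by rw [h, Complex.zero_im])
  set α := z.arg / 2 with hα
  have hα0 : 0 < α := half_pos ((Complex.arg_nonneg_iff.2 him.le).lt_of_ne' fun h =>
    him.ne' (Complex.arg_eq_zero_iff.1 h).2)
  have hαpi : α < Real.pi / 2 := div_lt_div_of_pos_right
    ((Complex.arg_le_pi z).lt_of_ne fun h => him.ne' (Complex.arg_eq_pi_iff.1 h).2) two_pos
  have hcos : 0 < Real.cos α := Real.cos_pos_of_mem_Ioo ⟨by linarith, hαpi⟩
  have hsin : 0 < Real.sin α := Real.sin_pos_of_pos_of_lt_pi hα0 (by linarith [Real.pi_pos])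
  have hw : √‖z‖ ^ 2 = ‖z‖ := Real.sq_sqrt (norm_nonneg z)
  refine ⟨Real.cos α, ⟨hcos, ?_⟩, √‖z‖, Real.sqrt_pos.2 (norm_pos_iff.2 hz), ?_, ?_⟩
  · nlinarith [Real.sin_sq_add_cos_sq α]
  · rw [hw, ← Real.cos_two_mul, hα, mul_div_cancel₀ _ two_ne_zero, Complex.norm_mul_cos_arg]
  · have h : ‖z‖ * (2 * Real.sin α * Real.cos α) = √2 * a := by
      rw [← Real.sin_two_mul, hα, mul_div_cancel₀ _ two_ne_zero, Complex.norm_mul_sin_arg]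
    rw [hw, ← Real.sin_eq_sqrt_one_sub_cos_sq hα0.le (by linarith [Real.pi_pos])]
    refine mul_left_cancel₀ (Real.sqrt_pos.2 two_pos).ne' ?_
    linear_combination -h - Real.cos α * ‖z‖ * Real.sin α * Real.sq_sqrt zero_le_two

end CnoidalWaves

section DirichletProblem

variable {μ k l b : ℝ} {j : ℕ} {u p : ℝ → ℝ}

theorem IsModulus.sq_lt_one (hk : IsModulus μ j k) : k ^ 2 < 1 :=
  pow_lt_one₀ hk.1.1 hk.1.2 two_ne_zero

theorem IsModulus.unique (hk : IsModulus μ j k) (hl : IsModulus μ j l) : k = l := by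
  have not_sq_lt {k l : ℝ} (hk : IsModulus μ j k) (hl : IsModulus μ j l) : ¬k ^ 2 < l ^ 2 := by
    intro hkl
    have h := mul_lt_mul_of_pos_left (two_mul_sq_sub_one_mul_ellK_sq_lt hkl hl.sq_lt_one)
      (show (0 : ℝ) < 4 * ((j : ℝ) + 1) ^ 2 by positivity)
    linarith [hk.2, hl.2]
  exact (sq_eq_sq₀ hk.1.1 hl.1.1).1
    (le_antisymm (not_lt.1 (not_sq_lt hl hk)) (not_lt.1 (not_sq_lt hk hl)))

theorem IsModulus.boundState_eq_boundStateFreq (hμ : 0 < μ) (hk : IsModulus μ j k) (x : ℝ) :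
    boundState j k x = boundStateFreq μ j k x := by
  have hK := ellK_pos hk.sq_lt_one
  have hμ' : μ = (2 * ((j : ℝ) + 1) * ellK k) ^ 2 * (2 * k ^ 2 - 1) := by
    linear_combination hk.2
  have hk2 : 0 < 2 * k ^ 2 - 1 := pos_of_mul_pos_right (hμ' ▸ hμ) (sq_nonneg _)
  have hsqrt : √μ = 2 * ((j : ℝ) + 1) * ellK k * √(2 * k ^ 2 - 1) := by
    rw [hμ', Real.sqrt_mul (sq_nonneg _), Real.sqrt_sq (by positivity)]
  rw [boundState, boundStateFreq, Real.sqrt_mul zero_le_two, hsqrt]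
  field_simp

theorem cnoidalWave_eq_neg_one_pow_mul_boundState (hk : k ^ 2 < 1) (j : ℕ) (x : ℝ) :
    cnoidalWave k (2 * (j + 1) * ellK k) x = (-1) ^ (j / 2) * boundState j k x := by
  have hj : (j : ℝ) = 2 * (j / 2 : ℕ) + (j % 2 : ℕ) := by
    exact_mod_cast (Nat.div_add_mod j 2).symm
  have hphase : 2 * ((j : ℝ) + 1) * ellK k * x - ellK k =
      2 * (j + 1) * ellK k * (x - 1 / 2) + (j % 2 : ℕ) * ellK k +
        (j / 2 : ℕ) * (2 * ellK k) := by
    linear_combination ellK k * hj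
  have hcn := (jacobiCn_antiperiodic hk).add_nat_mul_eq (j / 2) (x :=
    2 * ((j : ℝ) + 1) * ellK k * (x - 1 / 2) + (j % 2 : ℕ) * ellK k)
  rw [cnoidalWave, hphase, hcn, boundState]
  ring

theorem encard_zeros_cnoidalWave (hk0 : k ≠ 0) (hk : k ^ 2 < 1) (j : ℕ) :
    {x ∈ Ioo (0 : ℝ) 1 | cnoidalWave k (2 * (j + 1) * ellK k) x = 0}.encard = j := by
  have hK := ellK_pos hk
  have hj : (0 : ℝ) < j + 1 := by positivity
  have hzero (x : ℝ) :
      cnoidalWave k (2 * (j + 1) * ellK k) x = 0 ↔ ∃ m : ℤ, (m : ℝ) / (j + 1) = x := by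
    rw [cnoidalWave_eq_zero_iff hk0 hk (by positivity)]
    refine exists_congr fun m => ?_
    rw [div_eq_iff hj.ne']
    constructor <;> intro h
    · exact mul_left_cancel₀ (show 2 * ellK k ≠ 0 by positivity) (by linear_combination -h)
    · linear_combination -(2 * ellK k) * h
  have hset : {x ∈ Ioo (0 : ℝ) 1 | cnoidalWave k (2 * (j + 1) * ellK k) x = 0} =
      (fun m : ℤ => (m : ℝ) / (j + 1)) '' Finset.Ioo (0 : ℤ) (j + 1) := by
    ext x
    simp only [hzero, mem_ofPred_eq, mem_image, Finset.coe_Ioo]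
    constructor
    · rintro ⟨hx, m, rfl⟩
      rw [mem_Ioo, div_pos_iff_of_pos_right hj, div_lt_one hj] at hx
      exact ⟨m, by exact_mod_cast hx, rfl⟩
    · rintro ⟨m, hm, rfl⟩
      rw [mem_Ioo, div_pos_iff_of_pos_right hj, div_lt_one hj]
      exact ⟨by exact_mod_cast hm, m, rfl⟩
  have hinj : Function.Injective fun m : ℤ => (m : ℝ) / (j + 1) :=
    fun _ _ h => Int.cast_injective ((div_left_inj' hj.ne').1 h)
  rw [hset, hinj.encard_image, encard_coe_eq_coe_finsetCard, Int.card_Ioo]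
  simp

theorem exists_eqOn_cnoidalWave (h : IsNewtonSolutionOn (duffingForce μ) u p (Icc 0 b))
    (h0 : u 0 = 0) (hp0 : 0 < p 0) :
    ∃ k ∈ Ioo (0 : ℝ) 1, ∃ w > 0,
      μ = w ^ 2 * (2 * k ^ 2 - 1) ∧ EqOn u (cnoidalWave k w) (Icc 0 b) := by
  obtain ⟨k, hk, w, hw, hμ, hslope⟩ := exists_modulus_frequency μ hp0
  have hk1 : k ^ 2 < 1 := pow_lt_one₀ hk.1.le hk.2 two_ne_zero
  refine ⟨k, hk, w, hw, hμ, h.eqOn_Icc ((contDiff_duffingForce μ).of_le (by simp))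
    (hμ ▸ isNewtonSolutionOn_cnoidalWave hk1 w _) ?_ ?_⟩
  · rw [h0, cnoidalWave_zero hk1]
  · rw [hslope, cnoidalWaveDeriv_zero hk1]

theorem exists_isModulus_eqOn_cnoidalWave (h : IsNewtonSolutionOn (duffingForce μ) u p (Icc 0 1))
    (h0 : u 0 = 0) (h1 : u 1 = 0) (hp0 : 0 < p 0) :
    ∃ (j : ℕ) (k : ℝ), k ≠ 0 ∧ IsModulus μ j k ∧
      EqOn u (cnoidalWave k (2 * (j + 1) * ellK k)) (Icc 0 1) := by
  obtain ⟨k, hk, w, hw, hμ, hu⟩ := exists_eqOn_cnoidalWave h h0 hp0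
  have hk1 : k ^ 2 < 1 := pow_lt_one₀ hk.1.le hk.2 two_ne_zero
  have hK := ellK_pos hk1
  obtain ⟨m, hm⟩ := (cnoidalWave_eq_zero_iff hk.1.ne' hk1 hw.ne').1
    ((hu (right_mem_Icc.2 zero_le_one)).symm.trans h1)
  rw [mul_one] at hm
  have hm0 : (0 : ℝ) < m :=
    pos_of_mul_pos_right (pos_of_mul_pos_left (hm ▸ hw) hK.le) zero_le_two
  obtain ⟨j, rfl⟩ : ∃ j : ℕ, m = j + 1 := Int.eq_succ_of_zero_lt (by exact_mod_cast hm0)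
  push_cast at hm
  refine ⟨j, k, hk.1.ne', ⟨Ioo_subset_Ico_self hk, ?_⟩, hm ▸ hu⟩
  rw [hμ, hm]
  ring

theorem exists_isModulus_eqOn_boundState_or_neg
    (h : IsNewtonSolutionOn (duffingForce μ) u p (Icc 0 1)) (h0 : u 0 = 0) (h1 : u 1 = 0)
    (hne : ∃ x ∈ Icc (0 : ℝ) 1, u x ≠ 0) :
    ∃ (j : ℕ) (k : ℝ), IsModulus μ j k ∧ {x ∈ Ioo (0 : ℝ) 1 | u x = 0}.encard = j ∧
      (EqOn u (boundState j k) (Icc 0 1) ∨ EqOn u (-boundState j k) (Icc 0 1)) := by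
  wlog hp0 : 0 < p 0 generalizing u p
  · have hp0' : p 0 ≠ 0 := fun hp => by
      obtain ⟨x, hx, hux⟩ := hne
      exact hux (h.eqOn_Icc ((contDiff_duffingForce μ).of_le (by simp))
        (.zero (odd_duffingForce μ).map_zero (Icc 0 1)) h0 hp hx)
    obtain ⟨j, k, hk, hz, hb⟩ := this (h.neg (odd_duffingForce μ)) (by simp [h0]) (by simp [h1])
      (by simpa using hne) (neg_pos.2 ((not_lt.1 hp0).lt_of_ne hp0'))
    simp only [Pi.neg_apply, neg_eq_zero] at hz
    refine ⟨j, k, hk, hz, hb.symm.imp (fun h x hx => neg_injective (h hx)) fun h x hx => ?_⟩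
    exact neg_eq_iff_eq_neg.1 (h hx)
  · obtain ⟨j, k, hk0, hk, hu⟩ := exists_isModulus_eqOn_cnoidalWave h h0 h1 hp0
    refine ⟨j, k, hk, ?_, ?_⟩
    · rw [← encard_zeros_cnoidalWave hk0 hk.sq_lt_one j]
      congr 1
      ext x
      exact and_congr_right fun hx => by rw [hu (Ioo_subset_Icc_self hx)]
    · refine (neg_one_pow_eq_or ℝ (j / 2)).imp (fun hj x hx => ?_) fun hj x hx => ?_
      all_goals
        rw [hu hx, cnoidalWave_eq_neg_one_pow_mul_boundState hk.sq_lt_one, hj]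
        simp

end DirichletProblem

section WeakDerivative

open TopologicalSpace
open scoped Distributions

variable {a b : ℝ}

/-- The smooth real functions on the line with compact support in the interval `(a, b)`. -/
abbrev IntervalTestFunction (a b : ℝ) : Type :=
  𝓓((⟨Ioo a b, isOpen_Ioo⟩ : Opens ℝ), ℝ)

namespace IntervalTestFunction

variable {E : Type*} [NormedAddCommGroup E] [NormedSpace ℝ E] {f : ℝ → E}

/-- The derivative of a test function, as a test function. -/
noncomputable def derivative (η : IntervalTestFunction a b) : IntervalTestFunction a b where
  toFun := deriv η
  contDiff' := (contDiff_infty_iff_deriv.1 η.contDiff).2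
  hasCompactSupport' := η.hasCompactSupport.deriv
  tsupport_subset' := tsupport_deriv_subset.trans η.tsupport_subset

theorem hasDerivAt (η : IntervalTestFunction a b) (x : ℝ) : HasDerivAt η (η.derivative x) x :=
  (contDiff_infty_iff_deriv.1 η.contDiff).1.differentiableAt.hasDerivAt

theorem eq_zero (η : IntervalTestFunction a b) {x : ℝ} (hx : x ∉ Ioo a b) : η x = 0 :=
  image_eq_zero_of_notMem_tsupport fun h => hx (η.tsupport_subset h)

theorem integrable (η : IntervalTestFunction a b) : Integrable η :=
  η.continuous.integrable_of_hasCompactSupport η.hasCompactSupport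

theorem integrable_smul (η : IntervalTestFunction a b) (hf : LocallyIntegrableOn f (Ioo a b)) :
    Integrable fun x => η x • f x :=
  TestFunction.integrable_bilin (ContinuousLinearMap.lsmul ℝ ℝ) hf η

theorem setIntegral_smul (η : IntervalTestFunction a b) (f : ℝ → E) :
    ∫ x in Ioo a b, η x • f x = ∫ x, η x • f x :=
  setIntegral_eq_integral_of_forall_compl_eq_zero fun x hx => by rw [η.eq_zero hx, zero_smul]

theorem exists_tsupport_subset_Icc (η : IntervalTestFunction a b) :
    ∃ c d, tsupport η ⊆ Icc c d ∧ Icc c d ⊆ Ioo a b := by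
  rcases (tsupport η).eq_empty_or_nonempty with h | h
  · exact ⟨1, 0, by simp [h], by simp⟩
  · obtain ⟨c, hc⟩ := IsCompact.exists_isLeast η.hasCompactSupport h
    obtain ⟨d, hd⟩ := IsCompact.exists_isGreatest η.hasCompactSupport h
    exact ⟨c, d, fun x hx => ⟨hc.2 hx, hd.2 hx⟩,
      Icc_subset_Ioo (η.tsupport_subset hc.1).1 (η.tsupport_subset hd.1).2⟩

theorem exists_derivative_eq (η : IntervalTestFunction a b) (hη : ∫ x, η x = 0) :
    ∃ ξ : IntervalTestFunction a b, ξ.derivative = η := by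
  have hint := η.integrable
  have hderiv (x : ℝ) : HasDerivAt (fun x => ∫ t in Iic x, η t) (η x) x := by
    have hprim : (fun x => ∫ t in Iic x, η t) =
        fun x => (∫ t in Iic (0 : ℝ), η t) + ∫ t in 0..x, η t := funext fun x =>
      eq_add_of_sub_eq' (intervalIntegral.integral_Iic_sub_Iic hint.integrableOn hint.integrableOn)
    exact hprim ▸ (η.continuous.integral_hasStrictDerivAt 0 x).hasDerivAt.const_add _
  have hderiv' : deriv (fun x => ∫ t in Iic x, η t) = η := funext fun x => (hderiv x).deriv
  obtain ⟨c, d, hcd, hsub⟩ := η.exists_tsupport_subset_Icc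
  have hη0 {t : ℝ} (ht : t ∉ Icc c d) : η t = 0 :=
    image_eq_zero_of_notMem_tsupport fun h => ht (hcd h)
  have hsupp (x : ℝ) (hx : x ∉ Icc c d) : ∫ t in Iic x, η t = 0 := by
    rcases lt_or_ge x c with hxc | hcx
    · exact setIntegral_eq_zero_of_forall_eq_zero fun t ht =>
        hη0 fun h => (h.1.trans ht).not_gt hxc
    · rw [← hη]
      exact setIntegral_eq_integral_of_forall_compl_eq_zero fun t ht =>
        hη0 fun h => hx ⟨hcx, (not_le.1 ht).le.trans h.2⟩
  exact ⟨⟨fun x => ∫ t in Iic x, η t,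
    contDiff_infty_iff_deriv.2 ⟨fun x => (hderiv x).differentiableAt, hderiv'.symm ▸ η.contDiff⟩,
    .intro isCompact_Icc hsupp,
    (closure_minimal (fun x => not_imp_comm.1 (hsupp x)) isClosed_Icc).trans hsub⟩,
    DFunLike.coe_injective hderiv'⟩

theorem exists_integral_eq_one (hab : a < b) : ∃ η : IntervalTestFunction a b, ∫ x, η x = 1 := by
  obtain ⟨c, hc⟩ := nonempty_Ioo.2 hab
  obtain ⟨r, hr, hball⟩ := Metric.nhds_basis_closedBall.mem_iff.1 (Ioo_mem_nhds hc.1 hc.2)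
  let ρ : ContDiffBump c := ⟨r / 2, r, half_pos hr, half_lt_self hr⟩
  exact ⟨⟨ρ.normed volume, ρ.contDiff_normed, ρ.hasCompactSupport_normed,
    ρ.tsupport_normed_eq.trans_subset hball⟩, ρ.integral_normed⟩

end IntervalTestFunction

/-- The function `g` is a weak derivative of `f` on the interval `(a, b)`. Both functions are
defined on the line, but their values outside of `(a, b)` play no role. -/
structure HasWeakDerivOn {E : Type*} [NormedAddCommGroup E] [NormedSpace ℝ E] (f g : ℝ → E)
    (a b : ℝ) : Prop where
  locallyIntegrableOn : LocallyIntegrableOn f (Ioo a b)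
  locallyIntegrableOn_deriv : LocallyIntegrableOn g (Ioo a b)
  integral_derivative_smul (η : IntervalTestFunction a b) :
    ∫ x, η.derivative x • f x = -∫ x, η x • g x

namespace HasWeakDerivOn

variable {E : Type*} [NormedAddCommGroup E] [NormedSpace ℝ E] {f g F G : ℝ → E}

theorem of_hasDerivAt (hF : ∀ x, HasDerivAt F (g x) x) (hg : Continuous g) :
    HasWeakDerivOn F g a b := by
  have hFc : Continuous F := continuous_iff_continuousAt.2 fun x => (hF x).continuousAt
  have hFi : LocallyIntegrableOn F (Ioo a b) := hFc.locallyIntegrable.locallyIntegrableOn _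
  have hgi : LocallyIntegrableOn g (Ioo a b) := hg.locallyIntegrable.locallyIntegrableOn _
  refine ⟨hFi, hgi, fun η => ?_⟩
  have hη := η.integrable_smul hgi
  have hη' := η.derivative.integrable_smul hFi
  rw [eq_neg_iff_add_eq_zero, ← integral_add hη' hη]
  exact integral_eq_zero_of_hasDerivAt_of_integrable
    (fun x => ((η.hasDerivAt x).smul (hF x)).congr_deriv (add_comm _ _))
    (hη'.add hη) (η.integrable_smul hFi)

theorem sub (hf : HasWeakDerivOn f F a b) (hg : HasWeakDerivOn g G a b) :
    HasWeakDerivOn (f - g) (F - G) a b where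
  locallyIntegrableOn := hf.locallyIntegrableOn.sub hg.locallyIntegrableOn
  locallyIntegrableOn_deriv := hf.locallyIntegrableOn_deriv.sub hg.locallyIntegrableOn_deriv
  integral_derivative_smul η := by
    simp only [Pi.sub_apply, smul_sub]
    rw [integral_sub (η.derivative.integrable_smul hf.locallyIntegrableOn)
        (η.derivative.integrable_smul hg.locallyIntegrableOn),
      integral_sub (η.integrable_smul hf.locallyIntegrableOn_deriv)
        (η.integrable_smul hg.locallyIntegrableOn_deriv),
      hf.integral_derivative_smul, hg.integral_derivative_smul]
    abel

theorem congr_ae (h : HasWeakDerivOn f F a b) (hf : f =ᵐ[volume.restrict (Ioo a b)] g)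
    (hF : F =ᵐ[volume.restrict (Ioo a b)] G) : HasWeakDerivOn g G a b := by
  have hloc {u v : ℝ → E} (hu : LocallyIntegrableOn u (Ioo a b))
      (huv : u =ᵐ[volume.restrict (Ioo a b)] v) : LocallyIntegrableOn v (Ioo a b) := by
    rw [locallyIntegrableOn_iff isOpen_Ioo.isLocallyClosed] at hu ⊢
    exact fun s hs hsc => (hu s hs hsc).congr (ae_restrict_of_ae_restrict_of_subset hs huv)
  have hint {u v : ℝ → E} (huv : u =ᵐ[volume.restrict (Ioo a b)] v)
      (η : IntervalTestFunction a b) : ∫ x, η x • u x = ∫ x, η x • v x := by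
    refine integral_congr_ae ?_
    filter_upwards [(ae_restrict_iff' measurableSet_Ioo).1 huv] with x hx
    by_cases hxI : x ∈ Ioo a b
    · rw [hx hxI]
    · rw [η.eq_zero hxI, zero_smul, zero_smul]
  refine ⟨hloc h.locallyIntegrableOn hf, hloc h.locallyIntegrableOn_deriv hF, fun η => ?_⟩
  rw [← hint hf, ← hint hF, h.integral_derivative_smul]

/- If `∫ ρ = 1`, then `η - (∫ η) ρ` has integral zero and is therefore the derivative of a test
function. -/
theorem integral_smul_eq (h : HasWeakDerivOn f 0 a b) {ρ : IntervalTestFunction a b}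
    (hρ : ∫ x, ρ x = 1) (η : IntervalTestFunction a b) :
    ∫ x, η x • f x = (∫ x, η x) • ∫ x, ρ x • f x := by
  have hzero : ∫ x, (η - (∫ x, η x) • ρ) x = 0 := by
    simp only [sub_apply, smul_apply, smul_eq_mul]
    rw [integral_sub η.integrable (ρ.integrable.const_mul _), integral_const_mul, hρ, mul_one,
      sub_self]
  obtain ⟨ξ, hξ⟩ := (η - (∫ x, η x) • ρ).exists_derivative_eq hzero
  have hortho := h.integral_derivative_smul ξ
  simp only [hξ, sub_apply, smul_apply, smul_eq_mul, sub_smul, mul_smul, Pi.zero_apply,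
    smul_zero, integral_zero, neg_zero] at hortho
  rwa [integral_sub (η.integrable_smul h.locallyIntegrableOn)
    ((ρ.integrable_smul h.locallyIntegrableOn).fun_smul _), integral_smul, sub_eq_zero] at hortho

variable [CompleteSpace E]

theorem exists_ae_eq_const (hab : a < b) (h : HasWeakDerivOn f 0 a b) :
    ∃ c : E, f =ᵐ[volume.restrict (Ioo a b)] fun _ => c := by
  obtain ⟨ρ, hρ⟩ := IntervalTestFunction.exists_integral_eq_one hab
  have hconst : LocallyIntegrableOn (fun _ => ∫ x, ρ x • f x) (Ioo a b) :=
    locallyIntegrableOn_const _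
  refine ⟨∫ x, ρ x • f x, (ae_restrict_iff' measurableSet_Ioo).2 ?_⟩
  refine (isOpen_Ioo.ae_eq_zero_of_integral_contDiff_smul_eq_zero
    (h.locallyIntegrableOn.sub hconst) fun η hη hηc hηs => ?_).mono
    fun x hx hxI => sub_eq_zero.1 (hx hxI)
  let η' : IntervalTestFunction a b := ⟨η, hη, hηc, hηs⟩
  change ∫ x, η' x • (f x - ∫ x, ρ x • f x) = 0
  simp only [smul_sub]
  rw [integral_sub (η'.integrable_smul h.locallyIntegrableOn) (η'.integrable_smul hconst),
    integral_smul_const, sub_eq_zero]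
  exact h.integral_smul_eq hρ η'

theorem exists_hasDerivAt_ae_eq (hab : a < b) (h : HasWeakDerivOn f g a b) (hg : Continuous g) :
    ∃ F : ℝ → E, (∀ x, HasDerivAt F (g x) x) ∧ f =ᵐ[volume.restrict (Ioo a b)] F := by
  have hG (x : ℝ) : HasDerivAt (fun x => ∫ t in a..x, g t) (g x) x :=
    (hg.integral_hasStrictDerivAt a x).hasDerivAt
  obtain ⟨c, hc⟩ := exists_ae_eq_const hab (sub_self g ▸ h.sub (of_hasDerivAt hG hg))
  refine ⟨fun x => (∫ t in a..x, g t) + c, fun x => (hG x).add_const c, hc.mono fun x hx => ?_⟩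
  exact eq_add_of_sub_eq' hx

theorem exists_isNewtonSolutionOn {f : E → E} {u u' : ℝ → E} (hab : a < b) (hf : Continuous f)
    (hu : HasWeakDerivOn u u' a b) (hu' : HasWeakDerivOn u' (fun x => f (u x)) a b)
    (huc : ContinuousOn u (Icc a b)) : ∃ p, IsNewtonSolutionOn f u p (Icc a b) := by
  let w : ℝ → E := IccExtend hab.le ((Icc a b).domRestrict u)
  have hwc : Continuous w := huc.domRestrict.Icc_extend'
  have hwu : EqOn w u (Icc a b) := fun x hx => IccExtend_of_mem hab.le _ hx
  have hfwu : (fun x => f (u x)) =ᵐ[volume.restrict (Ioo a b)] fun x => f (w x) :=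
    (ae_restrict_mem measurableSet_Ioo).mono fun x hx =>
      congrArg f (hwu (Ioo_subset_Icc_self hx)).symm
  obtain ⟨p, hp, hup⟩ :=
    (hu'.congr_ae .rfl hfwu).exists_hasDerivAt_ae_eq hab (hf.comp hwc)
  have hpc : Continuous p := continuous_iff_continuousAt.2 fun x => (hp x).continuousAt
  obtain ⟨v, hv, huv⟩ := (hu.congr_ae .rfl hup).exists_hasDerivAt_ae_eq hab hpc
  have hvc : Continuous v := continuous_iff_continuousAt.2 fun x => (hv x).continuousAt
  rw [restrict_Ioo_eq_restrict_Icc] at huv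
  have huv' : EqOn u v (Icc a b) :=
    Measure.eqOn_Icc_of_ae_eq volume hab.ne huv huc hvc.continuousOn
  refine ⟨p, fun x hx => (hv x).hasDerivWithinAt.congr huv' (huv' hx), fun x hx => ?_⟩
  exact (hp x).hasDerivWithinAt.congr_deriv (congrArg f (hwu hx))

end HasWeakDerivOn

end WeakDerivative

section SobolevSpaces

variable {u u' g ψ ψ' : ℝ → ℝ}

instance isFiniteMeasure_unitVol : IsFiniteMeasure unitVol :=
  inferInstanceAs (IsFiniteMeasure (volume.restrict (Ioo (0 : ℝ) 1)))

theorem locallyIntegrableOn_of_memLp_unitVol (hu : MemLp u 2 unitVol) :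
    LocallyIntegrableOn u (Ioo 0 1) :=
  IntegrableOn.locallyIntegrableOn (hu.integrable one_le_two)

theorem MemH1.hasWeakDerivOn (h : MemH1 u u') : HasWeakDerivOn u u' 0 1 where
  locallyIntegrableOn := locallyIntegrableOn_of_memLp_unitVol h.memLp
  locallyIntegrableOn_deriv := locallyIntegrableOn_of_memLp_unitVol h.memLp_deriv
  integral_derivative_smul η := by
    have hweak := h.weak_deriv η η.contDiff η.hasCompactSupport η.tsupport_subset
    simp only [mul_comm (u _), mul_comm (u' _)] at hweak
    rw [← η.derivative.setIntegral_smul, ← η.setIntegral_smul]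
    exact hweak

theorem IntervalTestFunction.memH10 (η : IntervalTestFunction 0 1) : MemH10 η η.derivative where
  memLp := (η.continuous.memLp_of_hasCompactSupport η.hasCompactSupport).restrict _
  memLp_deriv :=
    (η.derivative.continuous.memLp_of_hasCompactSupport η.derivative.hasCompactSupport).restrict _
  weak_deriv ζ hζ hζc hζs := by
    let ζ' : IntervalTestFunction 0 1 := ⟨ζ, hζ, hζc, hζs⟩
    have hparts := (HasWeakDerivOn.of_hasDerivAt (a := 0) (b := 1) η.hasDerivAt
      η.derivative.continuous).integral_derivative_smul ζ'
    rw [← ζ'.derivative.setIntegral_smul, ← ζ'.setIntegral_smul] at hparts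
    simp only [smul_eq_mul, mul_comm (ζ'.derivative _), mul_comm (ζ' _)] at hparts
    exact hparts
  boundary := ⟨η, η.continuous.continuousOn, .rfl, η.eq_zero (by simp), η.eq_zero (by simp)⟩

theorem hasWeakDerivOn_of_integral_eq_zero (hu' : LocallyIntegrableOn u' (Ioo 0 1))
    (hg : LocallyIntegrableOn g (Ioo 0 1))
    (h : ∀ v v', MemH10 v v' → ∫ x, (u' x * v' x + g x * v x) ∂unitVol = 0) :
    HasWeakDerivOn u' g 0 1 := by
  refine ⟨hu', hg, fun η => ?_⟩
  have hη := h η η.derivative η.memH10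
  simp only [mul_comm (u' _), mul_comm (g _), ← smul_eq_mul] at hη
  rw [eq_neg_iff_add_eq_zero, ← η.derivative.setIntegral_smul, ← η.setIntegral_smul,
    ← integral_add (η.derivative.integrable_smul hu').restrict (η.integrable_smul hg).restrict]
  exact hη

theorem MemH10.exists_isNewtonSolutionOn {f : ℝ → ℝ} (hf : Continuous f) (hψ : MemH10 ψ ψ')
    (hweak : ∀ v v', MemH10 v v' → ∫ x, (ψ' x * v' x + f (ψ x) * v x) ∂unitVol = 0) :
    ∃ u p, u =ᵐ[unitVol] ψ ∧ u 0 = 0 ∧ u 1 = 0 ∧ IsNewtonSolutionOn f u p (Icc 0 1) := by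
  obtain ⟨u, huc, huψ, hu0, hu1⟩ := hψ.boundary
  have hfuψ : (fun x => f (u x)) =ᵐ[unitVol] fun x => f (ψ x) := huψ.fun_comp f
  have hfψ : IntegrableOn (fun x => f (ψ x)) (Ioo 0 1) :=
    (((hf.comp_continuousOn huc).integrableOn_Icc).mono_set Ioo_subset_Icc_self).congr hfuψ
  have hψ' := hψ.hasWeakDerivOn
  have hψ'' := hasWeakDerivOn_of_integral_eq_zero hψ'.locallyIntegrableOn_deriv
    hfψ.locallyIntegrableOn hweak
  obtain ⟨p, hp⟩ := (hψ'.congr_ae huψ.symm .rfl).exists_isNewtonSolutionOn zero_lt_one hf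
    (hψ''.congr_ae .rfl hfuψ.symm) huc
  exact ⟨u, p, huψ, hu0, hu1, hp⟩

end SobolevSpaces

theorem mainTheorem7_general (μ : ℝ) (ψ ψ' : ℝ → ℝ) (hψ : MemH10 ψ ψ')
    (hne : ¬ ψ =ᵐ[unitVol] 0)
    (hweak : ∀ v v' : ℝ → ℝ, MemH10 v v' →
      ∫ x, (ψ' x * v' x + μ * ψ x * v x - ψ x ^ 3 * v x) ∂unitVol = 0) :
    ∃ u : ℝ → ℝ, u =ᵐ[unitVol] ψ ∧
      ContDiffOn ℝ ∞ u (Ioo (0 : ℝ) 1) ∧ ContinuousOn u (Icc (0 : ℝ) 1) ∧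
      (∀ x ∈ Ioo (0 : ℝ) 1, -deriv (deriv u) x + μ * u x - u x ^ 3 = 0) ∧
      u 0 = 0 ∧ u 1 = 0 ∧
      ∃ j : ℕ,
        {x ∈ Ioo (0 : ℝ) 1 | u x = 0}.encard = (j : ℕ∞) ∧
        (∃! k : ℝ, IsModulus μ j k) ∧
        ∀ k : ℝ, IsModulus μ j k →
          ((∀ x ∈ Icc (0 : ℝ) 1, u x = boundState j k x) ∨
            (∀ x ∈ Icc (0 : ℝ) 1, u x = -boundState j k x)) ∧
          (0 < μ → ∀ x : ℝ, boundState j k x = boundStateFreq μ j k x) := by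
  have hforce (x y : ℝ) : μ * x * y - x ^ 3 * y = duffingForce μ x * y := (sub_mul ..).symm
  simp only [add_sub_assoc, hforce] at hweak
  obtain ⟨u, p, huψ, hu0, hu1, hu⟩ :=
    hψ.exists_isNewtonSolutionOn (contDiff_duffingForce μ).continuous hweak
  have hu' := hu.mono Ioo_subset_Icc_self
  have hu_ne : ∃ x ∈ Icc (0 : ℝ) 1, u x ≠ 0 := by
    by_contra! hzero
    exact hne (huψ.symm.trans ((ae_restrict_mem measurableSet_Ioo).mono fun x hx =>
      hzero x (Ioo_subset_Icc_self hx)))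
  obtain ⟨j, k, hk, hzeros, hbound⟩ := exists_isModulus_eqOn_boundState_or_neg hu hu0 hu1 hu_ne
  refine ⟨u, huψ, hu'.contDiffOn (contDiff_duffingForce μ) isOpen_Ioo.uniqueDiffOn,
    hu.continuousOn, fun x hx => ?_, hu0, hu1, j, hzeros,
    ⟨k, hk, fun l hl => hl.unique hk⟩, fun l hl => ⟨hl.unique hk ▸ hbound, fun hμ x =>
      hl.boundState_eq_boundStateFreq hμ x⟩⟩
  rw [hu'.deriv_deriv isOpen_Ioo hx, duffingForce]
  ring

theorem mainTheorem7 (μ : ℝ) (hμ : 0 ≤ μ) (ψ ψ' : ℝ → ℝ) (hψ : MemH10 ψ ψ')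
    (hne : ¬ ψ =ᵐ[unitVol] 0)
    (hweak : ∀ v v' : ℝ → ℝ, MemH10 v v' →
      ∫ x, (ψ' x * v' x + μ * ψ x * v x - ψ x ^ 3 * v x) ∂unitVol = 0) :
    ∃ u : ℝ → ℝ, u =ᵐ[unitVol] ψ ∧
      -- classical solution
      ContDiffOn ℝ ∞ u (Ioo (0 : ℝ) 1) ∧ ContinuousOn u (Icc (0 : ℝ) 1) ∧
      (∀ x ∈ Ioo (0 : ℝ) 1, -deriv (deriv u) x + μ * u x - u x ^ 3 = 0) ∧
      u 0 = 0 ∧ u 1 = 0 ∧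
      ∃ j : ℕ,
        -- exactly `j` interior zeros
        {x ∈ Ioo (0 : ℝ) 1 | u x = 0}.encard = (j : ℕ∞) ∧
        -- the modulus `k = k_j(μ)` is well defined, and `u = ± φ_j`
        (∃! k : ℝ, IsModulus μ j k) ∧
        ∀ k : ℝ, IsModulus μ j k →
          ((∀ x ∈ Icc (0 : ℝ) 1, u x = boundState j k x) ∨
            (∀ x ∈ Icc (0 : ℝ) 1, u x = -boundState j k x)) ∧
          (0 < μ → ∀ x : ℝ, boundState j k x = boundStateFreq μ j k x) :=
  mainTheorem7_general μ ψ ψ' hψ hne hweak
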